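/- **Theorem A.2.** Let $\mathbb{K}\in\{\mathbb{R},\mathbb{C}\}$. For every $j\in\mathbb{N}$ let $D_j$ be a set and let $k_j,\ell_j\colon D_j\times D_j\to\mathbb{K}$ be reproducing kernels (Hermitian positive semidefinite functions) with reproducing kernel Hilbert spaces $H(k_j)$ and $H(\ell_j)$. Assume that $H(k_j)\subseteq H(\ell_j)$ as sets of functions, and let $T_j\colon H(k_j)\hookrightarrow H(\ell_j)$ be the identical embedding, which is a bounded operator. Let $\mathbf{u}=(u_j)_{j\in\mathbb{N}}$ with $u_j\in H(k_j)$ satisfy $\|u_j\|_{H(k_j)}=\|u_j\|_{H(\ell_j)}=1$ for every $j$. Put $D:=\prod_{j\in\mathbb{N}}D_j$. Let $\mathfrak{X}^{(\mathbf{u})}$ be the set of all $\mathbf{x}=(x_j)_{j\in\mathbb{N}}\in D$ such that $$\sum_{j\in\mathbb{N}}\bigl|\|k_j(\cdot,x_j)\|_{H(k_j)}-1\bigr|<\infty\quad\text{and}\quad\sum_{j\in\mathbb{N}}|u_j(x_j)-1|<\infty$$ (the first condition is equivalent to $\sum_{j}|k_j(x_j,x_j)-1|<\infty$), and let $\mathfrak{Y}^{(\mathbf{u})}$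 be the set obtained in the same way from $\ell_j$ instead of $k_j$. The infinite products $$K^{(\mathbf{u})}(\mathbf{x},\mathbf{y}):=\prod_{j\in\mathbb{N}}k_j(x_j,y_j)\ \ (\mathbf{x},\mathbf{y}\in\mathfrak{X}^{(\mathbf{u})}),\qquad L^{(\mathbf{u})}(\mathbf{x},\mathbf{y}):=\prod_{j\in\mathbb{N}}\ell_j(x_j,y_j)\ \ (\mathbf{x},\mathbf{y}\in\mathfrak{Y}^{(\mathbf{u})})$$ converge and define reproducing kernels on $\mathfrak{X}^{(\mathbf{u})}$ and $\mathfrak{Y}^{(\mathbf{u})}$. If $\emptyset\neq\mathfrak{Y}^{(\mathbf{u})}\subseteq\mathfrak{X}^{(\mathbf{u})}$ and $\prod_{j\in\mathbb{N}}\|T_j\|<\infty$ (all factors are at least $1$), then $$\{f|_{\mathfrak{Y}^{(\mathbf{u})}}\colon f\in H(K^{(\mathbf{u})})\}\subseteq H(L^{(\mathbf{u})}),$$ and the operator norm of the restriction $T\colon H(K^{(\mathbf{u})})\to H(L^{(\mathbf{u})})$, $f\mapsto f|_{\mathfrak{Y}^{(\mathbf{u})}}$, is $$\|T\|=\prod_{j\in\mathbb{N}}\|T_j\|.$$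 -/

import Mathlib

noncomputable section

namespace TensorRKHS

open scoped ComplexOrder InnerProductSpace

/-- A reproducing kernel on the set `X` with values in `𝕜` (`ℝ` or `ℂ`): a function
`X × X → 𝕜` that is Hermitian and positive semidefinite, i.e.
`0 ≤ ∑ i j, conj (c i) * k (x i) (x j) * c j` for all finitely many points and coefficients.
No structure on `X` is needed. -/
structure Kernel (𝕜 : Type*) [RCLike 𝕜] (X : Type*) where
  /-- The underlying function of two variables. -/
  toFun : X → X → 𝕜
  /-- Hermitian symmetry and positive semidefiniteness. -/
  posSemidef : (Matrix.of toFun).PosSemidef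

/-- A scalar kernel, seen as a kernel with values in the operators on the one-dimensional
space `𝕜`; this is the form in which Mathlib treats reproducing kernels. -/
def Kernel.op {𝕜 : Type*} [RCLike 𝕜] {X : Type*} (k : Kernel 𝕜 X) :
    Matrix X X (𝕜 →L[𝕜] 𝕜) :=
  Matrix.of fun x y => k.toFun x y • ContinuousLinearMap.id 𝕜 𝕜

theorem Kernel.op_posSemidef {𝕜 : Type*} [RCLike 𝕜] {X : Type*} (k : Kernel 𝕜 X) :
    k.op.PosSemidef := by
  have hH : k.op.IsHermitian := by
    ext x y
    have h := k.posSemidef.1.apply x y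
    simp only [Matrix.of_apply] at h
    simp only [Kernel.op, Matrix.conjTranspose_apply, Matrix.of_apply, star_smul, h]
    have : star (ContinuousLinearMap.id 𝕜 𝕜) = ContinuousLinearMap.id 𝕜 𝕜 :=
      star_one (𝕜 →L[𝕜] 𝕜)
    rw [this]
  refine (RKHS.posSemidef_tfae (K := k.op) |>.out 0 2).mpr (And.intro hH fun v => ?_)
  have h := (RCLike.le_iff_re_im.mp (k.posSemidef.2 v)).1
  rw [map_zero] at h
  refine h.trans_eq ?_
  congr 1
  refine Finsupp.sum_congr fun x _ => Finsupp.sum_congr fun y _ => ?_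
  have h' := k.posSemidef.1.apply x y
  simp only [Matrix.of_apply, RCLike.star_def] at h'
  have e : k.op y x (v x) = k.toFun y x * v x := rfl
  rw [e, RCLike.inner_apply, map_mul, h', Matrix.of_apply, RCLike.star_def]
  ring

instance {𝕜 : Type*} [RCLike 𝕜] {X : Type*} (k : Kernel 𝕜 X) : Fact k.op.PosSemidef :=
  ⟨k.op_posSemidef⟩

/-- `H(k)`: the reproducing kernel Hilbert space with kernel `k`. Its elements are functions
`X → 𝕜` (through the coercion given by the class `RKHS`). -/
def H {𝕜 : Type*} [RCLike 𝕜] {X : Type*} (k : Kernel 𝕜 X) : Type _ := RKHS.OfKernel k.op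

instance {𝕜 : Type*} [RCLike 𝕜] {X : Type*} (k : Kernel 𝕜 X) : NormedAddCommGroup (H k) :=
  inferInstanceAs (NormedAddCommGroup (RKHS.OfKernel k.op))

instance {𝕜 : Type*} [RCLike 𝕜] {X : Type*} (k : Kernel 𝕜 X) : InnerProductSpace 𝕜 (H k) :=
  inferInstanceAs (InnerProductSpace 𝕜 (RKHS.OfKernel k.op))

instance {𝕜 : Type*} [RCLike 𝕜] {X : Type*} (k : Kernel 𝕜 X) : CompleteSpace (H k) :=
  inferInstanceAs (CompleteSpace (RKHS.OfKernel k.op))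

instance {𝕜 : Type*} [RCLike 𝕜] {X : Type*} (k : Kernel 𝕜 X) : RKHS 𝕜 (H k) X 𝕜 :=
  inferInstanceAs (RKHS 𝕜 (RKHS.OfKernel k.op) X 𝕜)

/-- The canonical feature `k(·, x)` as an element of `H(k)`. -/
def feature {𝕜 : Type*} [RCLike 𝕜] {X : Type*} (k : Kernel 𝕜 X) (x : X) : H k :=
  RKHS.kerFun (H k) x 1

theorem feature_apply {𝕜 : Type*} [RCLike 𝕜] {X : Type*} (k : Kernel 𝕜 X) (x y : X) :
    feature k y x = k.toFun x y := by
  have h : RKHS.kernel (H k) = k.op := RKHS.OfKernel.kernel_ofKernel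
  rw [feature, RKHS.kerFun_apply, h]
  simp [Kernel.op]

/-- The reproducing property `⟪k(·, x), f⟫ = f x` (the inner product is linear in its second
argument). -/
theorem inner_feature {𝕜 : Type*} [RCLike 𝕜] {X : Type*} (k : Kernel 𝕜 X) (x : X) (f : H k) :
    ⟪feature k x, f⟫_𝕜 = f x := by
  simp [feature, RKHS.kerFun_inner]

/-- For a map `φ : Y → X`: every `f ∈ H(k)` composed with `φ` is an element of `H(l)`.
With `φ = id` this says `H(k) ⊆ H(l)`; with `φ` the inclusion of `Y ⊆ X` it says that the
restrictions to `Y` of the functions in `H(k)` belong to `H(l)`. -/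
def MapsInto {𝕜 : Type*} [RCLike 𝕜] {X Y : Type*} (φ : Y → X) (k : Kernel 𝕜 X)
    (l : Kernel 𝕜 Y) : Prop :=
  ∀ f : H k, ∃ g : H l, ∀ y, g y = f (φ y)

/-- The linear map `f ↦ f ∘ φ` from `H(k)` to `H(l)`. -/
def compLin {𝕜 : Type*} [RCLike 𝕜] {X Y : Type*} {φ : Y → X} {k : Kernel 𝕜 X}
    {l : Kernel 𝕜 Y} (h : MapsInto φ k l) : H k →ₗ[𝕜] H l where
  toFun f := (h f).choose
  map_add' f g := by
    apply RKHS.ext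
    intro y
    refine ((h (f + g)).choose_spec y).trans ?_
    rw [RKHS.coe_add, Pi.add_apply, RKHS.coe_add, Pi.add_apply]
    exact congrArg₂ (· + ·) ((h f).choose_spec y).symm ((h g).choose_spec y).symm
  map_smul' c f := by
    apply RKHS.ext
    intro y
    refine ((h (c • f)).choose_spec y).trans ?_
    rw [RingHom.id_apply, RKHS.coe_smul, Pi.smul_apply, RKHS.coe_smul, Pi.smul_apply]
    exact congrArg (c • ·) ((h f).choose_spec y).symm

theorem compLin_apply {𝕜 : Type*} [RCLike 𝕜] {X Y : Type*} {φ : Y → X} {k : Kernel 𝕜 X}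
    {l : Kernel 𝕜 Y} (h : MapsInto φ k l) (f : H k) (y : Y) : compLin h f y = f (φ y) :=
  (h f).choose_spec y

theorem compLin_isClosed_graph {𝕜 : Type*} [RCLike 𝕜] {X Y : Type*} {φ : Y → X}
    {k : Kernel 𝕜 X} {l : Kernel 𝕜 Y} (h : MapsInto φ k l) :
    IsClosed ((compLin h).graph : Set (H k × H l)) := by
  have : ((compLin h).graph : Set (H k × H l)) = ⋂ y, {p | p.2 y = p.1 (φ y)} := by
    ext p
    simp only [SetLike.mem_coe, LinearMap.mem_graph_iff, Set.mem_iInter, Set.mem_ofPred_eq]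
    constructor
    · intro hp y
      rw [hp, compLin_apply]
    · intro hp
      apply RKHS.ext
      intro y
      rw [hp, compLin_apply]
  rw [this]
  exact isClosed_iInter fun y => isClosed_eq
    ((RKHS.continuous_eval y).comp continuous_snd)
    ((RKHS.continuous_eval (φ y)).comp continuous_fst)

/-- The bounded linear operator `f ↦ f ∘ φ` from `H(k)` to `H(l)`; it is bounded by the closed
graph theorem, and `‖compCLM h‖` is its operator norm. -/
def compCLM {𝕜 : Type*} [RCLike 𝕜] {X Y : Type*} {φ : Y → X} {k : Kernel 𝕜 X}
    {l : Kernel 𝕜 Y} (h : MapsInto φ k l) : H k →L[𝕜] H l :=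
  ContinuousLinearMap.ofIsClosedGraph (compLin_isClosed_graph h)

theorem compCLM_apply {𝕜 : Type*} [RCLike 𝕜] {X Y : Type*} {φ : Y → X} {k : Kernel 𝕜 X}
    {l : Kernel 𝕜 Y} (h : MapsInto φ k l) (f : H k) (y : Y) : compCLM h f y = f (φ y) :=
  compLin_apply h f y

/-- The set `C^(u)` of sequences `f` in a sequence of Hilbert spaces with
`∑ |‖f j‖ - 1| < ∞` and `∑ |⟪u j, f j⟫ - 1| < ∞`. -/
def seqSet {𝕜 : Type*} [RCLike 𝕜] {E : ℕ → Type*} [∀ j, NormedAddCommGroup (E j)]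
    [∀ j, InnerProductSpace 𝕜 (E j)] (u : ∀ j, E j) : Set (∀ j, E j) :=
  {f | Summable (fun j => |‖f j‖ - 1|) ∧ Summable (fun j => ‖⟪u j, f j⟫_𝕜 - 1‖)}

/-- The domain of the tensor product kernel: the set of all points `x` of the product `∏ D j`
such that the sequence of the `k_j(·, x_j)` belongs to `C^(u)`. -/
def domain {𝕜 : Type*} [RCLike 𝕜] {D : ℕ → Type*} (k : ∀ j, Kernel 𝕜 (D j))
    (u : ∀ j, H (k j)) : Set (∀ j, D j) :=
  {x | (fun j => feature (k j) (x j)) ∈ seqSet (𝕜 := 𝕜) u}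

theorem norm_feature_sq {𝕜 : Type*} [RCLike 𝕜] {X : Type*} (k : Kernel 𝕜 X) (x : X) :
    k.toFun x x = ((‖feature k x‖ ^ 2 : ℝ) : 𝕜) := by
  rw [← feature_apply, ← inner_feature, inner_self_eq_norm_sq_to_K]
  norm_cast

theorem summable_abs_sub_one_iff (a : ℕ → ℝ) (ha : ∀ j, 0 ≤ a j) :
    Summable (fun j => |a j ^ 2 - 1|) ↔ Summable (fun j => |a j - 1|) := by
  have key : ∀ j, |a j ^ 2 - 1| = |a j - 1| * (a j + 1) := fun j => by
    rw [show a j ^ 2 - 1 = (a j - 1) * (a j + 1) by ring, abs_mul,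
      abs_of_nonneg (by linarith [ha j] : 0 ≤ a j + 1)]
  constructor
  · intro h
    refine Summable.of_nonneg_of_le (fun j => abs_nonneg _) (fun j => ?_) h
    rw [key]
    nlinarith [ha j, abs_nonneg (a j - 1)]
  · intro h
    obtain ⟨C, hC⟩ := h.tendsto_atTop_zero.bddAbove_range
    refine Summable.of_nonneg_of_le (fun j => abs_nonneg _) (fun j => ?_) (h.mul_left (C + 2))
    have h1 : |a j - 1| ≤ C := hC ⟨j, rfl⟩
    rw [key, mul_comm]
    exact mul_le_mul_of_nonneg_right (by linarith [le_abs_self (a j - 1)]) (abs_nonneg _)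

/-- The domain in terms of kernel values and function values. -/
theorem mem_domain_iff {𝕜 : Type*} [RCLike 𝕜] {D : ℕ → Type*} (k : ∀ j, Kernel 𝕜 (D j))
    (u : ∀ j, H (k j)) (x : ∀ j, D j) :
    x ∈ domain k u ↔ Summable (fun j => ‖(k j).toFun (x j) (x j) - 1‖) ∧
      Summable (fun j => ‖u j (x j) - 1‖) := by
  have h1 : ∀ j, ‖(k j).toFun (x j) (x j) - 1‖ = |‖feature (k j) (x j)‖ ^ 2 - 1| := fun j => by
    rw [norm_feature_sq, ← RCLike.norm_ofReal (K := 𝕜)]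
    simp
  have h2 : ∀ j, ‖⟪u j, feature (k j) (x j)⟫_𝕜 - 1‖ = ‖u j (x j) - 1‖ := fun j => by
    rw [← inner_feature, ← inner_conj_symm, ← RCLike.norm_conj]
    simp
  simp only [domain, seqSet, Set.mem_ofPred_eq, h1, h2]
  rw [summable_abs_sub_one_iff _ fun j => norm_nonneg _]

/-- For points of the domain the factors `k_j(x_j, y_j)` are summably close to `1`. -/
theorem summable_kernel_sub_one {𝕜 : Type*} [RCLike 𝕜] {D : ℕ → Type*}
    (k : ∀ j, Kernel 𝕜 (D j)) (u : ∀ j, H (k j)) (hu : ∀ j, ‖u j‖ = 1)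
    {x y : ∀ j, D j} (hx : x ∈ domain k u) (hy : y ∈ domain k u) :
    Summable (fun j => ‖(k j).toFun (x j) (y j) - 1‖) := by
  have dist_sq : ∀ z ∈ domain k u, Summable fun j => ‖feature (k j) (z j) - u j‖ ^ 2 := by
    intro z hz
    have hz' := (mem_domain_iff k u z).1 hz
    refine Summable.of_nonneg_of_le (fun j => sq_nonneg _) (fun j => ?_)
      (hz'.1.add (hz'.2.mul_left 2))
    have h1 : ‖(k j).toFun (z j) (z j) - 1‖ = |‖feature (k j) (z j)‖ ^ 2 - 1| := by
      rw [norm_feature_sq, ← RCLike.norm_ofReal (K := 𝕜)]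
      simp
    have h2 := @norm_sub_sq 𝕜 (H (k j)) _ _ _ (feature (k j) (z j)) (u j)
    rw [inner_feature, hu] at h2
    have h3 := RCLike.abs_re_le_norm (u j (z j) - 1)
    rw [map_sub, RCLike.one_re] at h3
    rw [h1, h2]
    linarith [le_abs_self (‖feature (k j) (z j)‖ ^ 2 - 1), neg_abs_le (RCLike.re (u j (z j)) - 1)]
  have hx' := ((mem_domain_iff k u x).1 hx).2
  have hy' := ((mem_domain_iff k u y).1 hy).2
  refine Summable.of_nonneg_of_le (fun j => norm_nonneg _) (fun j => ?_)
    (((dist_sq x hx).add (dist_sq y hy)).add (hx'.add hy'))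
  set a := feature (k j) (x j)
  set b := feature (k j) (y j)
  have e : (k j).toFun (x j) (y j) - 1
      = ⟪a - u j, b - u j⟫_𝕜 + (⟪a, u j⟫_𝕜 - 1) + (⟪u j, b⟫_𝕜 - 1) := by
    have : ⟪u j, u j⟫_𝕜 = 1 := by rw [inner_self_eq_norm_sq_to_K, hu]; simp
    rw [← feature_apply, ← inner_feature, inner_sub_left, inner_sub_right, inner_sub_right, this]
    ring
  have e1 : ‖⟪a, u j⟫_𝕜 - 1‖ = ‖u j (x j) - 1‖ := by rw [inner_feature]
  have e2 : ‖⟪u j, b⟫_𝕜 - 1‖ = ‖u j (y j) - 1‖ := by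
    rw [← inner_feature, ← inner_conj_symm, ← RCLike.norm_conj]
    simp [b]
  have e3 := norm_inner_le_norm (𝕜 := 𝕜) (a - u j) (b - u j)
  rw [e]
  refine (norm_add₃_le).trans ?_
  rw [e1, e2]
  nlinarith [sq_nonneg (‖a - u j‖ - ‖b - u j‖), sq_nonneg (‖a - u j‖ + ‖b - u j‖)]

/-- The infinite product defining the tensor product kernel converges on the domain. -/
theorem multipliable_kernel {𝕜 : Type*} [RCLike 𝕜] {D : ℕ → Type*}
    (k : ∀ j, Kernel 𝕜 (D j)) (u : ∀ j, H (k j)) (hu : ∀ j, ‖u j‖ = 1)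
    {x y : ∀ j, D j} (hx : x ∈ domain k u) (hy : y ∈ domain k u) :
    Multipliable (fun j => (k j).toFun (x j) (y j)) := by
  have h := multipliable_one_add_of_summable (summable_kernel_sub_one k u hu hx hy)
  simpa using h

theorem posSemidef_prod {𝕜 : Type*} [RCLike 𝕜] {D : ℕ → Type*} {S : Set (∀ j, D j)}
    (k : ∀ j, Kernel 𝕜 (D j)) (s : Finset ℕ) :
    (Matrix.of fun x y : S => ∏ j ∈ s, (k j).toFun (x.1 j) (y.1 j)).PosSemidef := by
  classical
  induction s using Finset.induction_on with
  | empty =>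
    constructor
    · ext x y
      simp
    · intro c
      have : (c.sum fun i xi => c.sum fun j xj => star xi *
          (Matrix.of fun x y : S => ∏ j ∈ (∅ : Finset ℕ), (k j).toFun (x.1 j) (y.1 j)) i j * xj)
          = star (c.sum fun _ b => b) * c.sum fun _ b => b := by
        simp [Finsupp.sum, Finset.sum_mul_sum]
      rw [this]
      exact star_mul_self_nonneg _
  | insert a s ha ih =>
    have h1 := ((k a).posSemidef.submatrix fun x : S => x.1 a).hadamard ih
    convert h1 using 1
    ext x y
    simp [Finset.prod_insert ha]

/-- The tensor product kernel `(x, y) ↦ ∏ j, k_j(x_j, y_j)` on its domain. -/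
def tensorKernel {𝕜 : Type*} [RCLike 𝕜] {D : ℕ → Type*} (k : ∀ j, Kernel 𝕜 (D j))
    (u : ∀ j, H (k j)) (hu : ∀ j, ‖u j‖ = 1) : Kernel 𝕜 (domain k u) where
  toFun x y := ∏' j, (k j).toFun (x.1 j) (y.1 j)
  posSemidef := by
    have ht : ∀ x y : domain k u, Filter.Tendsto
        (fun s : Finset ℕ => ∏ j ∈ s, (k j).toFun (x.1 j) (y.1 j)) Filter.atTop
        (nhds (∏' j, (k j).toFun (x.1 j) (y.1 j))) := fun x y =>
      (multipliable_kernel k u hu x.2 y.2).hasProd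
    constructor
    · ext x y
      refine tendsto_nhds_unique (((continuous_star.tendsto _).comp (ht y x))) ?_
      refine (ht x y).congr fun s => ?_
      exact ((posSemidef_prod (S := domain k u) k s).1.apply x y).symm
    · intro c
      refine ge_of_tendsto' (x := Filter.atTop) (f := fun s : Finset ℕ =>
        c.sum fun i xi => c.sum fun j xj => star xi *
          (Matrix.of fun x y : domain k u => ∏ j ∈ s, (k j).toFun (x.1 j) (y.1 j)) i j * xj)
        ?_ fun s => (posSemidef_prod k s).2 c
      simp only [Finsupp.sum, Matrix.of_apply]
      exact tendsto_finsetSum _ fun i _ => tendsto_finsetSum _ fun j _ =>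
        ((ht i j).const_mul _).mul_const _

end TensorRKHS

end

/-! By the reproducing property, the adjoint of `f ↦ f ∘ φ` sends `feature l y` to `feature k (φ
y)`. Features span a dense subspace, so the operator exists with norm at most `C` exactly when `C ^
2 • l - k ∘ (φ × φ)` is positive semidefinite. Both inequalities for the norm become statements
about kernels.

Upper bound: the Schur product theorem multiplies the kernel inequalities of the factors over a
finite set `s` (`posSemidef_prod_norm_sq_smul_prodMatrix_sub`), and positive semidefiniteness
survives the limit in `s`.

Lower bound: fix `a` in the smaller domain and let only the coordinates in `s` vary. On such points
the infinite products are the finite products over `s` times constants, the tails at `a`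
(`tprod_piecewise`). The inequality given by `‖T‖` can then be stripped of one factor at a time,
each releasing `‖T_j‖ ^ 2` (`posSemidef_sub_norm_compCLM_sq_smul`, `mul_prod_norm_sq_le`). What
remains compares numbers, and the tails tend to `1`. -/

noncomputable section

namespace TensorRKHS

open scoped ComplexOrder InnerProductSpace Topology
open Filter Matrix

/-! ### Gram matrices and norm inequalities -/

section Gram

variable {𝕜 : Type*} [RCLike 𝕜] {X E F : Type*} [NormedAddCommGroup E]
  [InnerProductSpace 𝕜 E] [NormedAddCommGroup F] [InnerProductSpace 𝕜 F]

theorem sum_gram_eq_norm_sq (v : X → E) (c : X →₀ 𝕜) :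
    (c.sum fun i a => c.sum fun j b => star a * gram 𝕜 v i j * b) =
      ((‖Finsupp.linearCombination 𝕜 v c‖ ^ 2 : ℝ) : 𝕜) := by
  push_cast
  rw [← inner_self_eq_norm_sq_to_K, Finsupp.linearCombination_apply, Finsupp.sum_inner]
  refine Finsupp.sum_congr fun i _ => ?_
  rw [Finsupp.inner_sum]
  refine Finsupp.sum_congr fun j _ => ?_
  simp only [gram_apply, RCLike.star_def, inner_smul_left, inner_smul_right]
  ring

theorem posSemidef_gram_of_family (v : X → E) : (gram 𝕜 v).PosSemidef :=
  ⟨isHermitian_gram 𝕜 v, fun c => by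
    rw [sum_gram_eq_norm_sq]
    exact RCLike.ofReal_nonneg.2 (sq_nonneg _)⟩

theorem sum_smul_gram_sub_smul_gram (v : X → E) (w : X → F) (s t : ℝ) (c : X →₀ 𝕜) :
    (c.sum fun i a => c.sum fun j b => star a * (t • gram 𝕜 w - s • gram 𝕜 v) i j * b) =
      ((t * ‖Finsupp.linearCombination 𝕜 w c‖ ^ 2
        - s * ‖Finsupp.linearCombination 𝕜 v c‖ ^ 2 : ℝ) : 𝕜) := by
  rw [RCLike.ofReal_sub, RCLike.ofReal_mul, RCLike.ofReal_mul, ← sum_gram_eq_norm_sq, ← sum_gram_eq_norm_sq]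
  simp only [Finsupp.sum, Matrix.sub_apply, Matrix.smul_apply, RCLike.real_smul_eq_coe_mul,
    Finset.mul_sum, ← Finset.sum_sub_distrib]
  refine Finset.sum_congr rfl fun i _ => Finset.sum_congr rfl fun j _ => ?_
  ring

theorem posSemidef_smul_gram_sub_smul_gram_iff (v : X → E) (w : X → F) (s t : ℝ) :
    (t • gram 𝕜 w - s • gram 𝕜 v).PosSemidef ↔
      ∀ c : X →₀ 𝕜, s * ‖Finsupp.linearCombination 𝕜 v c‖ ^ 2 ≤
        t * ‖Finsupp.linearCombination 𝕜 w c‖ ^ 2 := by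
  constructor
  · intro h c
    have h' := h.2 c
    rw [sum_smul_gram_sub_smul_gram, RCLike.ofReal_nonneg] at h'
    linarith
  · refine fun h => ⟨?_, fun c => ?_⟩
    · exact ((isHermitian_gram 𝕜 w).smul (IsSelfAdjoint.all t)).sub
        ((isHermitian_gram 𝕜 v).smul (IsSelfAdjoint.all s))
    · rw [sum_smul_gram_sub_smul_gram, RCLike.ofReal_nonneg]
      linarith [h c]

theorem posSemidef_of_tendsto {ι : Type*} {f : Filter ι} [f.NeBot] {M : ι → Matrix X X 𝕜}
    {N : Matrix X X 𝕜} (hM : ∀ i, (M i).PosSemidef)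
    (hN : ∀ x y, Tendsto (fun i => M i x y) f (𝓝 (N x y))) : N.PosSemidef := by
  constructor
  · ext x y
    refine tendsto_nhds_unique ((continuous_star.tendsto _).comp (hN y x)) ?_
    exact (hN x y).congr fun i => ((hM i).1.apply x y).symm
  · intro c
    refine ge_of_tendsto' (x := f) (f := fun i =>
      c.sum fun x a => c.sum fun y b => star a * M i x y * b) ?_ fun i => (hM i).2 c
    simp only [Finsupp.sum]
    exact tendsto_finsetSum _ fun x _ => tendsto_finsetSum _ fun y _ =>
      ((hN x y).const_mul _).mul_const _

theorem norm_mul_le_of_sq_le (S : E →L[𝕜] F) {a b : ℝ} (ha : 0 ≤ a) (hb : 0 ≤ b)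
    (h : ∀ f, ‖S f‖ ^ 2 * a ^ 2 ≤ ‖f‖ ^ 2 * b ^ 2) : ‖S‖ * a ≤ b := by
  obtain rfl | ha' := ha.eq_or_lt
  · rwa [mul_zero]
  · rw [← le_div_iff₀ ha']
    refine S.opNorm_le_bound (by positivity) fun f => ?_
    rw [div_mul_eq_mul_div, le_div_iff₀ ha']
    refine le_of_sq_le_sq ?_ (by positivity)
    rw [mul_pow, mul_pow, mul_comm (b ^ 2)]
    exact h f

end Gram

/-! ### Operator norms of compositions as kernel inequalities -/

section Kernel

variable {𝕜 : Type*} [RCLike 𝕜] {X Y Z : Type*}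

theorem gram_feature (k : Kernel 𝕜 X) : gram 𝕜 (feature k) = Matrix.of k.toFun := by
  ext x y
  rw [gram_apply, inner_feature, feature_apply, of_apply]

/-- A positive semidefinite matrix is itself a kernel, and its features realize it as a Gram matrix.
This turns matrix inequalities into inequalities between norms. -/
theorem exists_gram_eq {M : Matrix X X 𝕜} (hM : M.PosSemidef) :
    ∃ (k : Kernel 𝕜 X), gram 𝕜 (feature k) = M :=
  ⟨⟨M, hM⟩, gram_feature _⟩

/-- Summing a positive semidefinite matrix over one of two coordinates against a fixed vector
gives a positive semidefinite matrix. -/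
theorem posSemidef_contract {M : Matrix (X × Z) (X × Z) 𝕜} (hM : M.PosSemidef) (v : X →₀ 𝕜) :
    (Matrix.of fun z z' => v.sum fun x a => v.sum fun x' a' =>
      star a * M (x, z) (x', z') * a').PosSemidef := by
  obtain ⟨m, rfl⟩ := exists_gram_eq hM
  -- The contraction is the Gram matrix of the vectors `∑ x, v x • feature m (x, z)`.
  convert posSemidef_gram_of_family (𝕜 := 𝕜)
    fun z => Finsupp.linearCombination 𝕜 (fun x => feature m (x, z)) v using 1
  ext z z'
  rw [of_apply, gram_apply, Finsupp.linearCombination_apply, Finsupp.sum_inner]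
  refine Finsupp.sum_congr fun i _ => ?_
  rw [Finsupp.linearCombination_apply, Finsupp.inner_sum]
  refine Finsupp.sum_congr fun j _ => ?_
  simp only [gram_apply, RCLike.star_def, inner_smul_left, inner_smul_right]
  ring

theorem denseRange_linearCombination_feature (k : Kernel 𝕜 X) :
    DenseRange (Finsupp.linearCombination 𝕜 (feature k)) := by
  have h : Submodule.span 𝕜 (Set.range (feature k)) =
      Submodule.span 𝕜 {RKHS.kerFun (H k) x v | (x) (v)} := by
    apply le_antisymm
    · exact Submodule.span_mono (Set.range_subset_iff.2 fun x => ⟨x, 1, rfl⟩)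
    · rw [Submodule.span_le]
      rintro _ ⟨x, v, rfl⟩
      have : RKHS.kerFun (H k) x v = v • feature k x := by
        rw [feature, ← map_smul, smul_eq_mul, mul_one]
      rw [this]
      exact Submodule.smul_mem _ _ (Submodule.subset_span ⟨x, rfl⟩)
  have h' := RKHS.kerFun_dense (H k)
  rw [← h, ← Finsupp.range_linearCombination] at h'
  have := Submodule.dense_iff_topologicalClosure_eq_top.2 h'
  rwa [LinearMap.coe_range] at this

theorem adjoint_compCLM_feature {φ : Y → X} {k : Kernel 𝕜 X} {l : Kernel 𝕜 Y}
    (h : MapsInto φ k l) (y : Y) :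
    (compCLM h).adjoint (feature l y) = feature k (φ y) := by
  refine ext_inner_right 𝕜 fun f => ?_
  rw [ContinuousLinearMap.adjoint_inner_left, inner_feature, inner_feature, compCLM_apply]

theorem adjoint_compCLM_linearCombination {φ : Y → X} {k : Kernel 𝕜 X} {l : Kernel 𝕜 Y}
    (h : MapsInto φ k l) (c : Y →₀ 𝕜) :
    (compCLM h).adjoint (Finsupp.linearCombination 𝕜 (feature l) c) =
      Finsupp.linearCombination 𝕜 (fun y => feature k (φ y)) c := by
  simp only [Finsupp.linearCombination_apply, map_finsuppSum, map_smul,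
    adjoint_compCLM_feature]

theorem gram_feature_comp (φ : Y → X) (k : Kernel 𝕜 X) :
    gram 𝕜 (fun y => feature k (φ y)) = (Matrix.of k.toFun).submatrix φ φ := by
  rw [← gram_feature]
  rfl

theorem posSemidef_norm_compCLM_sq_smul_sub {φ : Y → X} {k : Kernel 𝕜 X} {l : Kernel 𝕜 Y}
    (h : MapsInto φ k l) :
    (‖compCLM h‖ ^ 2 • Matrix.of l.toFun - (Matrix.of k.toFun).submatrix φ φ).PosSemidef := by
  have := posSemidef_opNorm_smul_gram_sub_gram (𝕜 := 𝕜) (feature l) (compCLM h).adjoint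
  rw [LinearIsometryEquiv.norm_map, gram_feature] at this
  convert this using 2
  rw [← gram_feature_comp]
  congr 1
  ext1 y
  exact (adjoint_compCLM_feature h y).symm

/-- Aronszajn's inclusion theorem: if `C ^ 2 • l - k ∘ (φ × φ)` is positive semidefinite, then
composition with `φ` maps `H k` to `H l` with norm at most `C`. -/
theorem exists_mapsInto_norm_compCLM_le {φ : Y → X} {k : Kernel 𝕜 X} {l : Kernel 𝕜 Y} {C : ℝ}
    (hC : 0 ≤ C)
    (h : (C ^ 2 • Matrix.of l.toFun - (Matrix.of k.toFun).submatrix φ φ).PosSemidef) :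
    ∃ h : MapsInto φ k l, ‖compCLM h‖ ≤ C := by
  rw [← gram_feature, ← gram_feature_comp, ← one_smul ℝ (gram 𝕜 fun y => feature k (φ y)),
    posSemidef_smul_gram_sub_smul_gram_iff] at h
  have hb : ∀ c : Y →₀ 𝕜, ‖Finsupp.linearCombination 𝕜 (fun y => feature k (φ y)) c‖ ≤
      C * ‖Finsupp.linearCombination 𝕜 (feature l) c‖ := fun c => by
    refine le_of_sq_le_sq ?_ (by positivity)
    rw [mul_pow]
    simpa using h c
  -- `S` is the future adjoint. The bound `hb` makes it well defined on the dense span of the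
  -- features and lets it extend.
  set S : H l →L[𝕜] H k := LinearMap.extendOfNorm
    (Finsupp.linearCombination 𝕜 (fun y => feature k (φ y)))
    (Finsupp.linearCombination 𝕜 (feature l))
  have hd := denseRange_linearCombination_feature l
  have hS : ∀ y, S (feature l y) = feature k (φ y) := fun y => by
    simpa using LinearMap.extendOfNorm_eq hd ⟨C, hb⟩ (Finsupp.single y 1)
  have hSn : ‖S‖ ≤ C := S.opNorm_le_bound hC (LinearMap.norm_extendOfNorm_apply_le hd C hb)
  have hSa : ∀ f y, S.adjoint f y = f (φ y) := fun f y => by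
    rw [← inner_feature, ContinuousLinearMap.adjoint_inner_right, hS, inner_feature]
  have hm : MapsInto φ k l := fun f => ⟨S.adjoint f, hSa f⟩
  refine ⟨hm, ?_⟩
  have : compCLM hm = S.adjoint := by
    ext1 f
    refine RKHS.ext fun y => ?_
    rw [compCLM_apply, hSa]
  rwa [this, LinearIsometryEquiv.norm_map]

/-- If `l ⊗ B - k ⊗ A` is positive semidefinite, then so is `B - ‖T‖ ^ 2 • A`, where `T` is the
embedding of `H k` into `H l`. -/
theorem posSemidef_sub_norm_compCLM_sq_smul {k l : Kernel 𝕜 X} (h : MapsInto id k l)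
    {A B : Matrix Z Z 𝕜} (hA : A.PosSemidef) (hB : B.PosSemidef)
    (hM : (Matrix.of fun p q : X × Z => l.toFun p.1 q.1 * B p.2 q.2
      - k.toFun p.1 q.1 * A p.2 q.2).PosSemidef) :
    (B - ‖compCLM h‖ ^ 2 • A).PosSemidef := by
  obtain ⟨a, rfl⟩ := exists_gram_eq hA
  obtain ⟨b, rfl⟩ := exists_gram_eq hB
  rw [← one_smul ℝ (gram 𝕜 (feature b)), posSemidef_smul_gram_sub_smul_gram_iff]
  intro w
  set α := Finsupp.linearCombination 𝕜 (feature a) w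
  set β := Finsupp.linearCombination 𝕜 (feature b) w
  set S := (compCLM h).adjoint
  have key : ∀ f : H l, ‖S f‖ ^ 2 * ‖α‖ ^ 2 ≤ ‖f‖ ^ 2 * ‖β‖ ^ 2 := by
    refine fun f => (denseRange_linearCombination_feature l).induction_on f
      (isClosed_le (by fun_prop) (by fun_prop)) fun v => ?_
    -- Contracting the first coordinate against `v` replaces `l` and `k` by the scalars `‖∑ v x •
    -- l(·, x)‖ ^ 2` and `‖∑ v x • k(·, x)‖ ^ 2`; the latter vector is `S` applied to the former.
    have hv := posSemidef_contract hM v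
    have e : (Matrix.of fun z z' => v.sum fun x c => v.sum fun x' c' => star c *
        (Matrix.of fun p q : X × Z => l.toFun p.1 q.1 * gram 𝕜 (feature b) p.2 q.2
          - k.toFun p.1 q.1 * gram 𝕜 (feature a) p.2 q.2) (x, z) (x', z') * c') =
        ‖Finsupp.linearCombination 𝕜 (feature l) v‖ ^ 2 • gram 𝕜 (feature b) -
        ‖Finsupp.linearCombination 𝕜 (feature k) v‖ ^ 2 • gram 𝕜 (feature a) := by
      ext z z'
      rw [Matrix.sub_apply, Matrix.smul_apply, Matrix.smul_apply, RCLike.real_smul_eq_coe_mul,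
        RCLike.real_smul_eq_coe_mul, ← sum_gram_eq_norm_sq, ← sum_gram_eq_norm_sq,
        gram_feature l, gram_feature k]
      simp only [Finsupp.sum, of_apply, Finset.sum_mul, ← Finset.sum_sub_distrib]
      refine Finset.sum_congr rfl fun i _ => Finset.sum_congr rfl fun j _ => ?_
      ring
    rw [e, posSemidef_smul_gram_sub_smul_gram_iff] at hv
    rw [adjoint_compCLM_linearCombination]
    exact hv w
  rw [one_mul]
  have := norm_mul_le_of_sq_le S (norm_nonneg α) (norm_nonneg β) key
  rw [LinearIsometryEquiv.norm_map] at this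
  rw [← mul_pow]
  gcongr

end Kernel

/-! ### Finite products: multiplying and stripping factors -/

section FiniteProduct

variable {𝕜 : Type*} [RCLike 𝕜] {D : ℕ → Type*}

/-- The kernel `(x, y) ↦ ∏ j ∈ s, k_j(x_j, y_j)` on the full product. -/
def prodMatrix (k : ∀ j, Kernel 𝕜 (D j)) (s : Finset ℕ) : Matrix (∀ j, D j) (∀ j, D j) 𝕜 :=
  Matrix.of fun x y => ∏ j ∈ s, (k j).toFun (x j) (y j)

theorem posSemidef_prodMatrix (k : ∀ j, Kernel 𝕜 (D j)) (s : Finset ℕ) :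
    (prodMatrix k s).PosSemidef :=
  (posSemidef_prod (S := Set.univ) k s).submatrix fun x => ⟨x, Set.mem_univ x⟩

theorem prodMatrix_insert (k : ∀ j, Kernel 𝕜 (D j)) {s : Finset ℕ} {i : ℕ} (hi : i ∉ s)
    (x y : ∀ j, D j) :
    prodMatrix k (insert i s) x y = (k i).toFun (x i) (y i) * prodMatrix k s x y :=
  Finset.prod_insert hi

variable {k l : ∀ j, Kernel 𝕜 (D j)} (hkl : ∀ j, MapsInto id (k j) (l j))

/-- With `c` the constant for `s` and `c_i = ‖T_i‖ ^ 2`, the inductive step splits `c_i c l_i L -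
k_i K` as `(c_i l_i - k_i) c L + k_i (c L - K)`, a sum of Schur products of positive semidefinite
kernels. -/
theorem posSemidef_prod_norm_sq_smul_prodMatrix_sub (s : Finset ℕ) :
    ((∏ j ∈ s, ‖compCLM (hkl j)‖ ^ 2) • prodMatrix l s - prodMatrix k s).PosSemidef := by
  induction s using Finset.induction_on with
  | empty =>
    have : (∏ j ∈ (∅ : Finset ℕ), ‖compCLM (hkl j)‖ ^ 2) • prodMatrix l ∅ - prodMatrix k ∅
        = 0 := by
      ext x y
      simp [prodMatrix]
    rw [this]
    exact PosSemidef.zero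
  | insert i s hi ih =>
    have h1 := ((posSemidef_norm_compCLM_sq_smul_sub (hkl i)).submatrix
      fun x : ∀ j, D j => x i).hadamard
      ((posSemidef_prodMatrix l s).smul (Finset.prod_nonneg fun j _ =>
        sq_nonneg ‖compCLM (hkl j)‖ : 0 ≤ ∏ j ∈ s, ‖compCLM (hkl j)‖ ^ 2))
    have h2 := ((k i).posSemidef.submatrix fun x : ∀ j, D j => x i).hadamard ih
    convert h1.add h2 using 1
    ext x y
    simp only [Matrix.sub_apply, Matrix.smul_apply, Matrix.add_apply, hadamard_apply,
      submatrix_apply, of_apply, prodMatrix_insert _ hi, Finset.prod_insert hi,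
      RCLike.real_smul_eq_coe_mul, id, RCLike.ofReal_mul]
    ring

/-- Each stripped factor multiplies `α` by `‖T_i‖ ^ 2`, hence the induction over all `α`. For empty
`s`, the diagonal entry at `a` gives `α ≤ β`. -/
theorem mul_prod_norm_sq_le (s : Finset ℕ) (a : ∀ j, D j) {α β : ℝ} (hα : 0 ≤ α) (hβ : 0 ≤ β)
    (h : (β • prodMatrix l s - α • prodMatrix k s).PosSemidef) :
    α * ∏ j ∈ s, ‖compCLM (hkl j)‖ ^ 2 ≤ β := by
  induction s using Finset.induction_on generalizing α with
  | empty =>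
    have h' := h.diag_nonneg (i := a)
    simp only [prodMatrix, Finset.prod_empty, Matrix.sub_apply, Matrix.smul_apply, of_apply,
      RCLike.real_smul_eq_coe_mul, mul_one, ← RCLike.ofReal_sub, RCLike.ofReal_nonneg] at h'
    simpa using h'
  | insert i s hi ih =>
    have hM : (Matrix.of fun p q : D i × (∀ j, D j) =>
        (l i).toFun p.1 q.1 * (β • prodMatrix l s) p.2 q.2
          - (k i).toFun p.1 q.1 * (α • prodMatrix k s) p.2 q.2).PosSemidef := by
      -- Since `i ∉ s`, the product over `s` ignores the updated coordinate, so the kernel splits as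
      -- a tensor product.
      convert h.submatrix fun p : D i × (∀ j, D j) => Function.update p.2 i p.1 using 1
      have hup : ∀ (m : ∀ j, Kernel 𝕜 (D j)) (p q : D i × ∀ j, D j),
          prodMatrix m s (Function.update p.2 i p.1) (Function.update q.2 i q.1) =
            prodMatrix m s p.2 q.2 := fun m p q =>
        Finset.prod_congr rfl fun j hj => by
          have : j ≠ i := fun e => hi (e ▸ hj)
          simp [Function.update_of_ne this]
      ext p q
      simp only [Matrix.sub_apply, Matrix.smul_apply, submatrix_apply, of_apply,
        prodMatrix_insert _ hi, RCLike.real_smul_eq_coe_mul, hup, Function.update_self]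
      ring
    have h1 := posSemidef_sub_norm_compCLM_sq_smul (hkl i)
      ((posSemidef_prodMatrix k s).smul hα) ((posSemidef_prodMatrix l s).smul hβ) hM
    rw [smul_smul] at h1
    have := ih (by positivity) h1
    rw [Finset.prod_insert hi]
    linarith

end FiniteProduct

/-! ### Tails of infinite products -/

section Tail

/-- The product of the factors with index outside `s`. -/
def tailProd (f : ℕ → ℝ) (s : Finset ℕ) : ℝ := ∏' j, if j ∈ s then 1 else f j

theorem multipliable_of_summable_abs_sub_one {f : ℕ → ℝ} (hf : Summable fun j => |f j - 1|) :
    Multipliable f := by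
  simpa using multipliable_one_add_of_summable (f := fun j => f j - 1) hf

theorem summable_abs_tail_sub_one {f : ℕ → ℝ} (hf : Summable fun j => |f j - 1|)
    (s : Finset ℕ) : Summable fun j => |(if j ∈ s then 1 else f j) - 1| := by
  refine Summable.of_nonneg_of_le (fun j => abs_nonneg _) (fun j => ?_) hf
  split_ifs <;> simp

theorem tailProd_nonneg {f : ℕ → ℝ} (hf : ∀ j, 0 ≤ f j) (s : Finset ℕ) : 0 ≤ tailProd f s := by
  by_cases h : Multipliable fun j => if j ∈ s then 1 else f j
  · refine ge_of_tendsto' h.hasProd fun t => Finset.prod_nonneg fun j _ => ?_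
    split_ifs
    exacts [zero_le_one, hf j]
  · rw [tailProd, tprod_eq_one_of_not_multipliable h]
    exact zero_le_one

theorem tendsto_tailProd {f : ℕ → ℝ} (hf : Summable fun j => |f j - 1|) :
    Tendsto (tailProd f) atTop (𝓝 1) := by
  refine Metric.tendsto_atTop.2 fun ε hε => ?_
  obtain ⟨s, hs⟩ := prod_vanishing_of_summable_norm (f := fun j => f j - 1) hf (half_pos hε)
  refine ⟨s, fun t ht => lt_of_le_of_lt ?_ (half_lt_self hε)⟩
  have h := (multipliable_of_summable_abs_sub_one (summable_abs_tail_sub_one hf t)).hasProd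
  refine le_of_tendsto' (h.dist tendsto_const_nhds) fun r => ?_
  -- Partial products of the tail run over sets disjoint from `t ⊇ s`, where `hs` gives the bound `ε
  -- / 2`.
  have e : ∏ j ∈ r, (if j ∈ t then 1 else f j) = ∏ j ∈ r \ t, (1 + (f j - 1)) := by
    rw [← Finset.filter_notMem_eq_sdiff, Finset.prod_filter]
    exact Finset.prod_congr rfl fun j _ => by split_ifs <;> simp_all
  rw [e, dist_eq_norm]
  exact (hs _ (Finset.sdiff_disjoint.mono_right ht)).le

end Tail

/-! ### Varying finitely many coordinates in the domain -/

section Domain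

variable {𝕜 : Type*} [RCLike 𝕜] {D : ℕ → Type*} {k : ∀ j, Kernel 𝕜 (D j)}
  {u : ∀ j, H (k j)}

theorem piecewise_mem_domain {a : ∀ j, D j} (ha : a ∈ domain k u) (s : Finset ℕ)
    (p : ∀ j, D j) : s.piecewise p a ∈ domain k u := by
  rw [mem_domain_iff] at ha ⊢
  have hs : ∀ᶠ j in cofinite, j ∉ s := s.finite_toSet.eventually_cofinite_notMem
  constructor
  · refine (summable_congr_cofinite (hs.mono fun j hj => ?_)).2 ha.1
    rw [Finset.piecewise_eq_of_notMem _ _ _ hj]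
  · refine (summable_congr_cofinite (hs.mono fun j hj => ?_)).2 ha.2
    rw [Finset.piecewise_eq_of_notMem _ _ _ hj]

theorem summable_abs_norm_feature_sq_sub_one {a : ∀ j, D j} (ha : a ∈ domain k u) :
    Summable fun j => |‖feature (k j) (a j)‖ ^ 2 - 1| :=
  (summable_abs_sub_one_iff _ fun _ => norm_nonneg _).2 ha.1

/-- Outside `s` both points have coordinate `a j`, so the factor there is `‖feature (k j) (a j)‖ ^
2`, independent of `p` and `q`. -/
theorem tprod_piecewise {a : ∀ j, D j} (ha : a ∈ domain k u) (s : Finset ℕ)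
    (p q : ∀ j, D j) :
    ∏' j, (k j).toFun (s.piecewise p a j) (s.piecewise q a j) =
      (tailProd (fun j => ‖feature (k j) (a j)‖ ^ 2) s : 𝕜) * prodMatrix k s p q := by
  have hm := multipliable_of_summable_abs_sub_one
    (summable_abs_tail_sub_one (summable_abs_norm_feature_sq_sub_one ha) s)
  have h1 := hm.hasProd.map (algebraMap ℝ 𝕜) (continuous_algebraMap ℝ 𝕜)
  have h2 : HasProd (fun j => if j ∈ s then (k j).toFun (p j) (q j) else 1)
      (prodMatrix k s p q) := by
    have := hasProd_prod_of_ne_finset_one (s := s)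
      (f := fun j => if j ∈ s then (k j).toFun (p j) (q j) else 1)
      (L := SummationFilter.unconditional ℕ) fun j hj => if_neg hj
    convert this using 1
    exact Finset.prod_congr rfl fun j hj => (if_pos hj).symm
  refine HasProd.tprod_eq ?_
  rw [tailProd, ← RCLike.algebraMap_eq_ofReal]
  convert h1.mul h2 using 1
  ext j
  by_cases hj : j ∈ s
  · simp [hj]
  · simp [hj, norm_feature_sq]

end Domain

/-! ### The norm of the restriction operator -/

section Main

variable {𝕜 : Type*} [RCLike 𝕜] {D : ℕ → Type*}

theorem exists_mapsInto_norm_compCLM_eq_tprod {k l : ∀ j, Kernel 𝕜 (D j)}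
    {u : ∀ j, H (k j)} (hu : ∀ j, ‖u j‖ = 1) (hkl : ∀ j, MapsInto id (k j) (l j))
    (hu' : ∀ j, ‖compCLM (hkl j) (u j)‖ = 1)
    (hne : (domain l fun j => compCLM (hkl j) (u j)).Nonempty)
    (hsub : domain l (fun j => compCLM (hkl j) (u j)) ⊆ domain k u)
    (hT : Multipliable fun j => ‖compCLM (hkl j)‖) :
    ∃ h : MapsInto (Set.inclusion hsub) (tensorKernel k u hu)
        (tensorKernel l (fun j => compCLM (hkl j) (u j)) hu'),
      ‖compCLM h‖ = ∏' j, ‖compCLM (hkl j)‖ := by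
  have hlim : Tendsto (fun s : Finset ℕ => ∏ j ∈ s, ‖compCLM (hkl j)‖ ^ 2) atTop
      (𝓝 ((∏' j, ‖compCLM (hkl j)‖) ^ 2)) := by
    simp only [Finset.prod_pow]
    exact Tendsto.pow hT.hasProd 2
  have hnn : 0 ≤ ∏' j, ‖compCLM (hkl j)‖ :=
    ge_of_tendsto' hT.hasProd fun s => Finset.prod_nonneg fun j _ => norm_nonneg _
  have hub : ((∏' j, ‖compCLM (hkl j)‖) ^ 2 •
      Matrix.of (tensorKernel l (fun j => compCLM (hkl j) (u j)) hu').toFun -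
      (Matrix.of (tensorKernel k u hu).toFun).submatrix (Set.inclusion hsub)
        (Set.inclusion hsub)).PosSemidef := by
    refine posSemidef_of_tendsto (f := atTop) (fun s : Finset ℕ =>
      (posSemidef_prod_norm_sq_smul_prodMatrix_sub hkl s).submatrix Subtype.val) fun x y => ?_
    have hl := (multipliable_kernel l _ hu' x.2 y.2).hasProd
    have hk := (multipliable_kernel k u hu (hsub x.2) (hsub y.2)).hasProd
    exact (hlim.smul hl).sub hk
  obtain ⟨h, hle⟩ := exists_mapsInto_norm_compCLM_le hnn hub
  refine ⟨h, hle.antisymm ?_⟩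
  obtain ⟨a, ha⟩ := hne
  -- The tails stay on both sides without division, as they may vanish for small `s`; only their
  -- limit `1` matters.
  have hfin : ∀ s : Finset ℕ, tailProd (fun j => ‖feature (k j) (a j)‖ ^ 2) s *
      ∏ j ∈ s, ‖compCLM (hkl j)‖ ^ 2 ≤
      ‖compCLM h‖ ^ 2 * tailProd (fun j => ‖feature (l j) (a j)‖ ^ 2) s := fun s => by
    have hk := tailProd_nonneg (fun j => sq_nonneg ‖feature (k j) (a j)‖) s
    have hl := tailProd_nonneg (fun j => sq_nonneg ‖feature (l j) (a j)‖) s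
    refine mul_prod_norm_sq_le hkl s a hk (by positivity) ?_
    convert (posSemidef_norm_compCLM_sq_smul_sub h).submatrix
      fun p => ⟨s.piecewise p a, piecewise_mem_domain ha s p⟩ using 1
    ext p q
    have e1 := tprod_piecewise ha s p q
    have e2 := tprod_piecewise (hsub ha) s p q
    simp only [Matrix.sub_apply, Matrix.smul_apply, Matrix.submatrix_apply, Matrix.of_apply,
      tensorKernel, Set.inclusion, e1, e2, RCLike.real_smul_eq_coe_mul, RCLike.ofReal_mul]
    ring
  have h1 := (tendsto_tailProd (summable_abs_norm_feature_sq_sub_one (hsub ha))).mul hlim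
  have h2 := (tendsto_tailProd (summable_abs_norm_feature_sq_sub_one ha)).const_mul
    (‖compCLM h‖ ^ 2)
  have h3 := le_of_tendsto_of_tendsto' h1 h2 hfin
  rw [one_mul, mul_one] at h3
  exact le_of_sq_le_sq h3 (norm_nonneg _)

end Main

end TensorRKHS

end

theorem theoremA2 {𝕜 : Type*} [RCLike 𝕜] {D : ℕ → Type*}
    (k l : ∀ j, TensorRKHS.Kernel 𝕜 (D j))
    (u : ∀ j, TensorRKHS.H (k j)) (hu : ∀ j, ‖u j‖ = 1)
    -- `H(k_j) ⊆ H(l_j)`; the identical embedding `T_j` is `TensorRKHS.compCLM (hkl j)`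
    (hkl : ∀ j, TensorRKHS.MapsInto id (k j) (l j))
    (hu' : ∀ j, ‖TensorRKHS.compCLM (hkl j) (u j)‖ = 1)
    (hne : (TensorRKHS.domain l fun j => TensorRKHS.compCLM (hkl j) (u j)).Nonempty)
    (hsub : TensorRKHS.domain l (fun j => TensorRKHS.compCLM (hkl j) (u j)) ⊆
      TensorRKHS.domain k u)
    -- all factors are at least `1`, so this says that the product is finite
    (hT : Multipliable fun j => ‖TensorRKHS.compCLM (hkl j)‖) :
    ∃ h : TensorRKHS.MapsInto (Set.inclusion hsub) (TensorRKHS.tensorKernel k u hu)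
        (TensorRKHS.tensorKernel l (fun j => TensorRKHS.compCLM (hkl j) (u j)) hu'),
      ‖TensorRKHS.compCLM h‖ = ∏' j, ‖TensorRKHS.compCLM (hkl j)‖ := by
  exact TensorRKHS.exists_mapsInto_norm_compCLM_eq_tprod hu hkl hu' hne hsub hT
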